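/- Let $(G,X)$ and $(M,X_M)$ be Shimura data in the sense of Deligne: $G$ is a connected reductive algebraic group over $\mathbb{Q}$, $X$ is a $G(\mathbb{R})$-conjugacy class of homomorphisms $h:\mathbb{S}=\mathrm{Res}_{\mathbb{C}/\mathbb{R}}\mathbb{G}_m\to G_{\mathbb{R}}$ such that for $h\in X$ the Hodge structure on $\mathrm{Lie}(G)$ given by $\mathrm{Ad}\circ h$ is of type $\{(-1,1),(0,0),(1,-1)\}$, conjugation by $h(i)$ is a Cartan involution of $G^{ad}_{\mathbb{R}}$, and $G^{ad}$ has no nontrivial direct factor over $\mathbb{Q}$ on which the projection of $h$ is trivial; likewise for $(M,X_M)$. Here $H^{ad}:=H/Z(H)$ denotes the quotient of an algebraic group $H$ by its centre, and for $h:\mathbb{S}\to H_{\mathbb{R}}$ we write $h^{ad}:\mathbb{S}\to H^{ad}_{\mathbb{R}}$ for the composite of $h$ with the quotient map. For $x'\in X$ let $(M_{x'},X_{x'})$ be the Mumford–Tate datum of $x'$, that is, the smallest Shimura subdatum of $(G,X)$ with $x'\in X_{x'}$. Let $x\in X_M$ be Hodge generic, that is, the Mumford–Tate group of $x$ contains the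 Mumford–Tate group of every point of $X_M$. Then the hybrid Hecke orbit \[ \Sigma_X(M,X_M,x)=\{x'\in X : \text{there is a morphism } \phi:M^{ad}\to M_{x'}^{ad} \text{ of algebraic groups over } \mathbb{Q} \text{ with } \phi\circ x^{ad}=x'^{ad}\} \] is countable. -/

import Mathlib

open scoped TensorProduct

universe u v

namespace HybridHecke

/-! ### The Deligne torus -/

open MvPolynomial in
/-- The norm form `a² + b²`. -/
noncomputable abbrev normForm : MvPolynomial (Fin 2) ℝ := X 0 ^ 2 + X 1 ^ 2

/-- The coordinate ring `ℝ[a, b, (a² + b²)⁻¹]` of the Deligne torus `𝕊 = Res_{ℂ/ℝ} 𝔾ₘ`;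
the point `(a, b)` stands for `a + b i`. -/
abbrev DeligneRing : Type := Localization.Away normForm

namespace DeligneRing
open MvPolynomial
/-- The coordinate function `a` (real part). -/
noncomputable def a : DeligneRing := algebraMap (MvPolynomial (Fin 2) ℝ) DeligneRing (X 0)
/-- The coordinate function `b` (imaginary part). -/
noncomputable def b : DeligneRing := algebraMap (MvPolynomial (Fin 2) ℝ) DeligneRing (X 1)

lemma isUnit_norm : IsUnit (a ^ 2 + b ^ 2) := by
  have h := IsLocalization.Away.algebraMap_isUnit (S := DeligneRing) normForm
  simpa [a, b] using h

variable {B : Type*} [CommRing B] [Algebra ℝ B]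

/-- The algebra map out of `DeligneRing` with `a ↦ u` and `b ↦ v`. -/
noncomputable def lift (u v : B) (h : IsUnit (u ^ 2 + v ^ 2)) : DeligneRing →ₐ[ℝ] B :=
  IsLocalization.liftAlgHom (M := Submonoid.powers normForm)
    (f := MvPolynomial.aeval (fun i : Fin 2 => if i = 0 then u else v)) (by
      rintro ⟨_, n, rfl⟩
      simpa using h.pow n)

@[simp] lemma lift_a (u v : B) (h : IsUnit (u ^ 2 + v ^ 2)) : lift u v h a = u := by
  simp [lift, a]

@[simp] lemma lift_b (u v : B) (h : IsUnit (u ^ 2 + v ^ 2)) : lift u v h b = v := by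
  simp [lift, b]

lemma algHom_ext {f g : DeligneRing →ₐ[ℝ] B} (ha : f a = g a) (hb : f b = g b) : f = g := by
  apply IsLocalization.algHom_ext (Submonoid.powers normForm)
  apply MvPolynomial.algHom_ext
  intro i
  fin_cases i
  · exact ha
  · exact hb

/-- `(a + b i)(a' + b' i) = (a a' - b b') + (a b' + b a') i`. -/
noncomputable def comulHom : DeligneRing →ₐ[ℝ] DeligneRing ⊗[ℝ] DeligneRing :=
  lift (a ⊗ₜ a - b ⊗ₜ b) (a ⊗ₜ b + b ⊗ₜ a) (by
    have h : (a ⊗ₜ[ℝ] a - b ⊗ₜ[ℝ] b) ^ 2 + (a ⊗ₜ[ℝ] b + b ⊗ₜ[ℝ] a) ^ 2 =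
        ((a ^ 2 + b ^ 2) ⊗ₜ[ℝ] 1) * (1 ⊗ₜ[ℝ] (a ^ 2 + b ^ 2)) := by
      simp only [sq, sub_mul, mul_sub, add_mul, mul_add, Algebra.TensorProduct.tmul_mul_tmul,
        TensorProduct.add_tmul, TensorProduct.tmul_add, one_mul, mul_one, mul_comm b a]
      abel
    rw [h]
    exact (isUnit_norm.map (Algebra.TensorProduct.includeLeft (R := ℝ) (S := ℝ)
      (A := DeligneRing) (B := DeligneRing))).mul
      (isUnit_norm.map (Algebra.TensorProduct.includeRight (R := ℝ)
      (A := DeligneRing) (B := DeligneRing))))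

/-- Evaluation at `1`. -/
noncomputable def counitHom : DeligneRing →ₐ[ℝ] ℝ := lift 1 0 (by simp)

/-- `(a² + b²)⁻¹`. -/
noncomputable def normInv : DeligneRing := ((isUnit_norm.unit⁻¹ : DeligneRingˣ) : DeligneRing)

lemma norm_mul_normInv : (a ^ 2 + b ^ 2) * normInv = 1 := isUnit_norm.mul_val_inv

/-- `(a + b i)⁻¹ = (a - b i) / (a² + b²)`. -/
noncomputable def antipodeHom : DeligneRing →ₐ[ℝ] DeligneRing :=
  lift (a * normInv) (-(b * normInv)) (by
    apply IsUnit.of_mul_eq_one (a ^ 2 + b ^ 2)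
    linear_combination (1 + (a ^ 2 + b ^ 2) * normInv) * norm_mul_normInv)

noncomputable instance : Bialgebra ℝ DeligneRing :=
  Bialgebra.ofAlgHom comulHom counitHom
    (by
      apply algHom_ext (B := DeligneRing ⊗[ℝ] (DeligneRing ⊗[ℝ] DeligneRing)) <;>
      simp [comulHom, TensorProduct.sub_tmul, TensorProduct.add_tmul, TensorProduct.tmul_sub,
        TensorProduct.tmul_add] <;> abel)
    (by apply algHom_ext <;> simp [comulHom, counitHom])
    (by apply algHom_ext <;> simp [comulHom, counitHom])

noncomputable instance : HopfAlgebra ℝ DeligneRing :=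
  HopfAlgebra.ofAlgHom antipodeHom
    (by
      apply algHom_ext
      · change Algebra.TensorProduct.lift _ _ (fun _ _ => Commute.all _ _) (comulHom a) = algebraMap ℝ DeligneRing (counitHom a)
        simp [comulHom, counitHom, antipodeHom]
        linear_combination norm_mul_normInv
      · change Algebra.TensorProduct.lift _ _ (fun _ _ => Commute.all _ _) (comulHom b) = algebraMap ℝ DeligneRing (counitHom b)
        simp [comulHom, counitHom, antipodeHom]
        ring)
    (by
      apply algHom_ext
      · change Algebra.TensorProduct.lift _ _ (fun _ _ => Commute.all _ _) (comulHom a) = algebraMap ℝ DeligneRing (counitHom a)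
        simp [comulHom, counitHom, antipodeHom]
        linear_combination norm_mul_normInv
      · change Algebra.TensorProduct.lift _ _ (fun _ _ => Commute.all _ _) (comulHom b) = algebraMap ℝ DeligneRing (counitHom b)
        simp [comulHom, counitHom, antipodeHom]
        ring)

/-- Evaluation of functions on the Deligne torus at `z ∈ 𝕊(ℝ) = ℂˣ`. -/
noncomputable def evalAt (z : ℂˣ) : DeligneRing →ₐ[ℝ] ℝ :=
  lift (z : ℂ).re (z : ℂ).im (by
    have h : Complex.normSq (z : ℂ) ≠ 0 := Complex.normSq_eq_zero.not.mpr z.ne_zero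
    rw [Complex.normSq_apply] at h
    simpa [sq] using h)

end DeligneRing

/-! ### Affine algebraic groups, as commutative Hopf algebras of finite type -/

open WithConv

/-- The points of an affine group scheme form a group under convolution. -/
noncomputable instance convPointsGroup {k A R : Type*} [CommRing k] [CommRing A]
    [HopfAlgebra k A] [CommRing R] [Algebra k R] : Group (WithConv (A →ₐ[k] R)) where
  inv f := toConv (f.ofConv.comp (HopfAlgebra.antipodeAlgHom k A))
  inv_mul_cancel f := by
    apply WithConv.ofConv_injective
    have h := AlgHom.comp_convMul_distrib (B := R) f.ofConv
      (toConv (HopfAlgebra.antipodeAlgHom k A)) (toConv (AlgHom.id k A))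
    rw [AlgHom.antipode_id_cancel] at h
    refine h.symm.trans ?_
    ext; simp [AlgHom.convOne_def]

/-- An affine algebraic group over a field `k`, given by its coordinate ring. -/
structure AlgGrp (k : Type) [Field k] where
  /-- The coordinate ring. -/
  coord : Type u
  [commRing : CommRing coord]
  [hopfAlgebra : HopfAlgebra k coord]
  [finiteType : Algebra.FiniteType k coord]

attribute [instance] AlgGrp.commRing AlgGrp.hopfAlgebra AlgGrp.finiteType

namespace AlgGrp

variable {k : Type} [Field k]

/-- The group `G(R)`. -/
abbrev Points (G : AlgGrp.{u} k) (R : Type*) [CommRing R] [Algebra k R] :=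
  WithConv (G.coord →ₐ[k] R)

/-- The map `G(R) → G(R')` induced by `R → R'`. -/
def Points.map {G : AlgGrp.{u} k} {R R' : Type*} [CommRing R] [Algebra k R] [CommRing R']
    [Algebra k R'] (f : R →ₐ[k] R') (g : G.Points R) : G.Points R' :=
  toConv (f.comp g.ofConv)

/-- Morphisms of algebraic groups over `k`, given by their comorphisms. -/
abbrev Hom (G : AlgGrp.{u} k) (H : AlgGrp.{v} k) := H.coord →ₐc[k] G.coord

/-- The composite `ψ ∘ φ` of morphisms of algebraic groups. -/
def Hom.andThen {G : AlgGrp.{u} k} {H : AlgGrp.{v} k} {K : AlgGrp k}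
    (φ : Hom G H) (ψ : Hom H K) : Hom G K :=
  BialgHom.comp φ ψ

/-- The map `G(R) → H(R)` induced by `φ : G → H`. -/
def Hom.onPoints {G : AlgGrp.{u} k} {H : AlgGrp.{v} k} (φ : Hom G H) {R : Type*} [CommRing R]
    [Algebra k R] (g : G.Points R) : H.Points R :=
  toConv (g.ofConv.comp (φ : H.coord →ₐ[k] G.coord))

/-- A morphism of algebraic groups is trivial if it factors through the trivial group. -/
def Hom.IsTrivial {G : AlgGrp.{u} k} {H : AlgGrp.{v} k} (φ : Hom G H) : Prop :=
  ∀ f : H.coord, φ f = algebraMap k G.coord (Coalgebra.counit f)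

/-- The trivial algebraic group: its coordinate ring is `k`. -/
def IsTrivial (G : AlgGrp.{u} k) : Prop := Function.Surjective (algebraMap k G.coord)

/-- Closed immersions of algebraic groups, that is, inclusions of closed subgroups. -/
def Hom.IsClosedImmersion {G : AlgGrp.{u} k} {H : AlgGrp.{v} k} (φ : Hom G H) : Prop :=
  Function.Surjective φ

/-- Quotient maps of algebraic groups: faithfully flat morphisms. -/
def Hom.IsQuotientMap {G : AlgGrp.{u} k} {H : AlgGrp.{v} k} (φ : Hom G H) : Prop :=
  ((φ : H.coord →ₐ[k] G.coord) : H.coord →+* G.coord).FaithfullyFlat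

/-- Extension of scalars `G_K`. -/
noncomputable def baseChange (G : AlgGrp.{u} k) (K : Type) [Field K] [Algebra k K] :
    AlgGrp.{u} K where
  coord := K ⊗[k] G.coord

/-- Extension of scalars of a morphism. -/
noncomputable def Hom.baseChange {G : AlgGrp.{u} k} {H : AlgGrp.{v} k} (φ : Hom G H) (K : Type)
    [Field K] [Algebra k K] : Hom (G.baseChange K) (H.baseChange K) :=
  Bialgebra.TensorProduct.map (BialgHom.id K K) φ

/-! ### Centre and adjoint group -/

/-- The points `Z(G)(R)` of the scheme-theoretic centre: those `z ∈ G(R)` that commute with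
`G(R')` for every `R`-algebra `R'`. -/
def IsCentral (G : AlgGrp.{u} k) {R : Type u} [CommRing R] [Algebra k R] (z : G.Points R) :
    Prop :=
  ∀ (R' : Type u) [CommRing R'] [Algebra k R'] (f : R →ₐ[k] R') (g : G.Points R'),
    z.map f * g = g * z.map f

/-- The adjoint group `G^ad = G / Z(G)`: an algebraic group with a quotient map from `G` whose
kernel is the centre of `G`. Such a quotient is unique up to unique isomorphism. -/
structure AdjointQuotient (G : AlgGrp.{u} k) where
  /-- The group `G^ad`. -/
  grp : AlgGrp.{u} k
  /-- The quotient map `G → G^ad`. -/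
  proj : Hom G grp
  isQuotientMap : proj.IsQuotientMap
  ker_eq_centre : ∀ (R : Type u) [CommRing R] [Algebra k R] (g : G.Points R),
    proj.onPoints g = 1 ↔ G.IsCentral g

/-! ### Reductive groups -/

/-- Linear representations of `G` on `V`, that is, `O(G)`-comodule structures on `V`. -/
structure IsRepresentation (G : AlgGrp.{u} k) {V : Type} [AddCommGroup V] [Module k V]
    (ρ : V →ₗ[k] V ⊗[k] G.coord) : Prop where
  coassoc : (TensorProduct.assoc k V G.coord G.coord).toLinearMap ∘ₗ
    ρ.rTensor G.coord ∘ₗ ρ = Coalgebra.comul.lTensor V ∘ₗ ρ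
  counit : (TensorProduct.rid k V).toLinearMap ∘ₗ Coalgebra.counit.lTensor V ∘ₗ ρ = LinearMap.id

/-- `G` is unipotent if every nonzero finite-dimensional representation has a nonzero fixed
vector. -/
def IsUnipotent (G : AlgGrp.{u} k) : Prop :=
  ∀ (V : Type) [AddCommGroup V] [Module k V] [Module.Finite k V] [Nontrivial V]
    (ρ : V →ₗ[k] V ⊗[k] G.coord), G.IsRepresentation ρ → ∃ v : V, v ≠ 0 ∧ ρ v = v ⊗ₜ[k] 1

/-- `ι : N → G` has normal image. -/
def Hom.IsNormal {N G : AlgGrp.{u} k} (ι : Hom N G) : Prop :=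
  ∀ (R : Type u) [CommRing R] [Algebra k R] (n : N.Points R) (g : G.Points R),
    ∃ n' : N.Points R, ι.onPoints n' = g * ι.onPoints n * g⁻¹

/-- Connected algebraic groups. -/
def IsConnected (G : AlgGrp.{u} k) : Prop := ConnectedSpace (PrimeSpectrum G.coord)

/-- Connected reductive groups: `G` is connected and smooth (that is, geometrically reduced), and
over an algebraic closure its only smooth connected unipotent normal subgroup is trivial. -/
structure IsReductive (G : AlgGrp.{u} k) : Prop where
  connected : G.IsConnected
  smooth : IsReduced (G.baseChange (AlgebraicClosure k)).coord
  unipotentRadical : ∀ (N : AlgGrp.{u} (AlgebraicClosure k))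
    (ι : Hom N (G.baseChange (AlgebraicClosure k))), ι.IsClosedImmersion → ι.IsNormal →
    IsReduced N.coord → N.IsConnected → N.IsUnipotent → N.IsTrivial

/-! ### Lie algebra and adjoint action -/

/-- The elements of `Lie(G) ⊗ R`, as point derivations `O(G) → R` at the identity. -/
def IsTangent (G : AlgGrp.{u} k) {R : Type*} [CommRing R] [Algebra k R]
    (D : G.coord →ₗ[k] R) : Prop :=
  ∀ f g : G.coord, D (f * g) =
    (Coalgebra.counit f : k) • D g + (Coalgebra.counit g : k) • D f

/-- The adjoint action `Ad(g) D = g D g⁻¹` of `G(R)` on `Lie(G) ⊗ R`, with the products taken in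
the convolution algebra of linear maps `O(G) → R`. -/
noncomputable def Ad (G : AlgGrp.{u} k) {R : Type*} [CommRing R] [Algebra k R]
    (g : G.Points R) (D : G.coord →ₗ[k] R) : G.coord →ₗ[k] R :=
  (toConv g.ofConv.toLinearMap * toConv D * toConv (g⁻¹).ofConv.toLinearMap).ofConv

/-! ### Cartan involutions -/

/-- Conjugation by `c ∈ G(ℝ)` is a Cartan involution of the real algebraic group `G`: it is an
involution, and the real form `{g ∈ G(ℂ) : c ḡ c⁻¹ = g}` is compact. The topology of `G(ℂ)` is
that of pointwise convergence of maps `O(G) → ℂ`. -/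
def IsCartanInvolution (G : AlgGrp.{u} ℝ) (c : G.Points ℝ) : Prop :=
  (∀ g : G.Points ℂ, let c' := c.map (Algebra.ofId ℝ ℂ)
    c' * (c' * g * c'⁻¹) * c'⁻¹ = g) ∧
  IsCompact ((fun (g : G.Points ℂ) (f : G.coord) => g.ofConv f) '' {g : G.Points ℂ |
    c.map (Algebra.ofId ℝ ℂ) * g.map (Complex.conjAe : ℂ →ₐ[ℝ] ℂ) *
      (c.map (Algebra.ofId ℝ ℂ))⁻¹ = g})

end AlgGrp

/-! ### Shimura data -/

open AlgGrp

/-- The Deligne torus `𝕊 = Res_{ℂ/ℝ} 𝔾ₘ`. -/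
noncomputable def deligneTorus : AlgGrp.{0} ℝ where
  coord := DeligneRing

/-- Homomorphisms `h : 𝕊 → G_ℝ` of real algebraic groups. -/
abbrev DeligneHom (G : AlgGrp.{u} ℚ) := Hom deligneTorus (G.baseChange ℝ)

namespace DeligneHom

variable {G : AlgGrp.{u} ℚ}

/-- The point `h(z) ∈ G(ℝ)`, for `z ∈ 𝕊(ℝ) = ℂˣ`. -/
noncomputable def eval (h : DeligneHom G) (z : ℂˣ) : (G.baseChange ℝ).Points ℝ :=
  Hom.onPoints h (G := deligneTorus) (toConv (DeligneRing.evalAt z))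

/-- The composite `φ ∘ h : 𝕊 → H_ℝ`, for `φ : G → H` defined over `ℚ`. -/
noncomputable def push {H : AlgGrp.{v} ℚ} (h : DeligneHom G) (φ : Hom G H) : DeligneHom H :=
  Hom.andThen h (φ.baseChange ℝ)

/-- `h' = g h g⁻¹`, for `g ∈ G(ℝ)`. Here `h` and `h'` are read as points of `G_ℝ` with values in
`O(𝕊)`. -/
def IsConjBy (g : (G.baseChange ℝ).Points ℝ) (h h' : DeligneHom G) : Prop :=
  (toConv (h' : (G.baseChange ℝ).coord →ₐ[ℝ] deligneTorus.coord) :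
      (G.baseChange ℝ).Points deligneTorus.coord) =
    g.map (Algebra.ofId ℝ deligneTorus.coord) *
      toConv (h : (G.baseChange ℝ).coord →ₐ[ℝ] deligneTorus.coord) *
      (g.map (Algebra.ofId ℝ deligneTorus.coord))⁻¹

/-- The `G(ℝ)`-conjugacy class of `h`. -/
def conjClass (h : DeligneHom G) : Set (DeligneHom G) := {h' | ∃ g, IsConjBy g h h'}

/-- The Hodge structure on `Lie(G)` defined by `Ad ∘ h` is of type `{(-1,1), (0,0), (1,-1)}`:
`Lie(G) ⊗ ℂ` is the sum of the subspaces where `z ∈ 𝕊(ℝ) = ℂˣ` acts by `z / z̄`, `1`, `z̄ / z`. -/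
def IsHodgeTypeAdjoint (h : DeligneHom G) : Prop :=
  ∀ D : (G.baseChange ℝ).coord →ₗ[ℝ] ℂ, (G.baseChange ℝ).IsTangent D →
    ∃ D₁ D₂ D₃ : (G.baseChange ℝ).coord →ₗ[ℝ] ℂ,
      (G.baseChange ℝ).IsTangent D₁ ∧ (G.baseChange ℝ).IsTangent D₂ ∧
      (G.baseChange ℝ).IsTangent D₃ ∧ D = D₁ + D₂ + D₃ ∧
      ∀ z : ℂˣ, let g := (h.eval z).map (Algebra.ofId ℝ ℂ)
        (G.baseChange ℝ).Ad g D₁ = ((z : ℂ) / star (z : ℂ)) • D₁ ∧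
        (G.baseChange ℝ).Ad g D₂ = D₂ ∧
        (G.baseChange ℝ).Ad g D₃ = (star (z : ℂ) / (z : ℂ)) • D₃

/-- The projection of `h` to every nontrivial direct factor `F` of `Q = F × F'` over `ℚ` is
nontrivial. -/
def NontrivialOnFactors {Q : AlgGrp.{u} ℚ} (h : DeligneHom Q) : Prop :=
  ∀ (F F' : AlgGrp.{u} ℚ) (q : Hom Q F) (q' : Hom Q F'),
    Function.Bijective (Algebra.TensorProduct.productMap
      (q : F.coord →ₐ[ℚ] Q.coord) (q' : F'.coord →ₐ[ℚ] Q.coord)) →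
    (h.push q).IsTrivial → F.IsTrivial

end DeligneHom

/-- Shimura data `(G, X)` in the sense of Deligne. -/
structure ShimuraDatum where
  /-- The group `G`. -/
  G : AlgGrp.{u} ℚ
  /-- The `G(ℝ)`-conjugacy class `X` of homomorphisms `𝕊 → G_ℝ`. -/
  X : Set (DeligneHom G)
  reductive : G.IsReductive
  isConjClass : ∃ h : DeligneHom G, X = h.conjClass
  hodgeType : ∀ h ∈ X, h.IsHodgeTypeAdjoint
  cartan : ∀ h ∈ X, ∃ P : AdjointQuotient G,
    (P.grp.baseChange ℝ).IsCartanInvolution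
      (DeligneHom.eval (h.push P.proj) (Units.mk0 Complex.I Complex.I_ne_zero))
  noTrivialFactor : ∀ h ∈ X, ∃ P : AdjointQuotient G, (h.push P.proj).NontrivialOnFactors

/-- `ι` makes `(H, X_H)` a Shimura subdatum of `(G, X)`. -/
structure IsSubdatum (H D : ShimuraDatum.{u}) (ι : Hom H.G D.G) : Prop where
  isClosedImmersion : ι.IsClosedImmersion
  mapsTo : ∀ y ∈ H.X, DeligneHom.push y ι ∈ D.X

/-- The Mumford-Tate datum of `x`: the smallest Shimura subdatum `(M_x, X_x)` of `(G, X)` such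
that `x ∈ X_x`. -/
structure MumfordTateDatum (D : ShimuraDatum.{u}) (x : DeligneHom D.G) where
  /-- The datum `(M_x, X_x)`. -/
  datum : ShimuraDatum.{u}
  /-- The inclusion `M_x → G`. -/
  incl : Hom datum.G D.G
  isSubdatum : IsSubdatum datum D incl
  /-- The point `x`, as an element of `X_x`. -/
  point : DeligneHom datum.G
  point_mem : point ∈ datum.X
  push_point : point.push incl = x
  smallest : ∀ (H : ShimuraDatum.{u}) (ι : Hom H.G D.G), IsSubdatum H D ι →
    (∃ y ∈ H.X, DeligneHom.push y ι = x) →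
    ∃ j : Hom datum.G H.G, IsSubdatum datum H j ∧ Hom.andThen j ι = incl

/-- `x ∈ X` is Hodge generic: its Mumford-Tate group contains the Mumford-Tate group of every
point of `X`; that is, every element of `X` factors through `H_ℝ`, for every Shimura subdatum
`(H, X_H)` with `x ∈ X_H`. -/
def IsHodgeGeneric (D : ShimuraDatum.{u}) (x : DeligneHom D.G) : Prop :=
  ∀ (H : ShimuraDatum.{u}) (ι : Hom H.G D.G), IsSubdatum H D ι →
    (∃ y ∈ H.X, DeligneHom.push y ι = x) →
    ∀ x₁ ∈ D.X, ∃ y₁ : DeligneHom H.G, y₁.push ι = x₁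

/-- The hybrid Hecke orbit `Σ_X(M, X_M, x)`: the points `x' ∈ X` for which there is a morphism
`φ : M^ad → M_{x'}^ad` over `ℚ` with `φ ∘ x^ad = x'^ad`. -/
def hybridHeckeOrbit (D : ShimuraDatum.{u}) (M : ShimuraDatum.{v}) (x : DeligneHom M.G) :
    Set (DeligneHom D.G) :=
  {x' | x' ∈ D.X ∧ ∃ (T : MumfordTateDatum D x') (P : AdjointQuotient M.G)
    (P' : AdjointQuotient T.datum.G) (φ : Hom P.grp P'.grp),
      DeligneHom.push (DeligneHom.push x P.proj) φ = DeligneHom.push T.point P'.proj}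

end HybridHecke

namespace HybridHecke

open WithConv

/-! ### Commuting idempotents in a convolution algebra -/

/-! The orbit is cut into countably many strata. A stratum records the ideal `I` of `M_{x'}` in
`O(G)` and finitely many pairs `(s, t)`, where the `s` restrict to generators of `O(M_{x'}^ad)` and
the `t` are their pullbacks to `M` through `φ`. Since `O(G)` is countable and Noetherian and `O(M)`
is countable, there are countably many choices (`exists_mem_orbitStratum`).

Two points of one stratum factor through the same subgroup `H` and agree in `H^ad`, so they differ
by a central point and commute (`commute_of_mem_orbitStratum`).

A pairwise commuting family of homomorphisms `𝕊 → G_ℝ` is countable (`countable_of_commute`). For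
each `h` and each character `χ` of `𝕊`, the functional sending `f` to the `χ`-coefficient of `f ∘ h`
is an idempotent of the convolution algebra, and all these idempotents commute. At a fixed `f` they
take finitely many values, so `f ∘ h` has countably many possible expansions. As `O(G)` is finitely
generated, countably many `h` remain. -/

lemma finite_isIdempotentElem_of_isArtinianRing (R : Type*) [CommRing R] [IsArtinianRing R] :
    {e : R | IsIdempotentElem e}.Finite := by
  have : Finite (TopologicalSpace.Clopens (PrimeSpectrum R)) :=
    Finite.of_injective (fun U => (U : Set (PrimeSpectrum R))) SetLike.coe_injective
  exact Set.finite_coe_iff.mp <| Finite.of_equiv _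
    (PrimeSpectrum.isIdempotentElemEquivClopens (R := R)).symm.toEquiv

/-- A linear functional on a commutative algebra takes only finitely many values on idempotents
if the associated bilinear form `(e, g) ↦ l (e * g)` has finite rank. -/
lemma finite_image_isIdempotentElem {K E ι : Type*} [Field K] [CommRing E] [Algebra K E]
    [Finite ι] (l : E →ₗ[K] K) (ev : E →ₗ[K] (ι → K))
    (hl : ∀ e g : E, ev e = 0 → l (e * g) = 0) :
    (l '' {e | IsIdempotentElem e}).Finite := by
  -- `J` is the radical of the form `(e, g) ↦ l (e * g)`. It contains `ker ev`, so `E ⧸ J` is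
  -- finite-dimensional, hence Artinian, with finitely many idempotents.
  let J : Ideal E :=
    { carrier := {e | ∀ g : E, l (e * g) = 0}
      add_mem' := fun {a b} ha hb g => by rw [add_mul, map_add, ha g, hb g, add_zero]
      zero_mem' := fun g => by rw [zero_mul, map_zero]
      smul_mem' := fun c e he g => by
        rw [smul_eq_mul, mul_comm c e, mul_assoc]
        exact he (c * g) }
  have hker : LinearMap.ker ev ≤ J.restrictScalars K := fun e he g => hl e g he
  have : Module.Finite K (E ⧸ LinearMap.ker ev) :=
    Module.Finite.equiv ev.quotKerEquivRange.symm
  have : Module.Finite K (E ⧸ J.restrictScalars K) :=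
    Module.Finite.of_surjective (Submodule.factor hker) (Submodule.factor_surjective hker)
  have : Module.Finite K (E ⧸ J) :=
    Module.Finite.equiv (Submodule.Quotient.restrictScalarsEquiv K J)
  have : IsArtinianRing (E ⧸ J) := IsArtinianRing.of_finite K (E ⧸ J)
  refine ((finite_isIdempotentElem_of_isArtinianRing (E ⧸ J)).image fun q =>
    l (Quotient.out q)).subset ?_
  rintro _ ⟨e, he, rfl⟩
  refine ⟨Ideal.Quotient.mk J e, he.map _, ?_⟩
  -- Testing membership in `J` against `g = 1` shows that `l` depends only on the class modulo `J`.
  have h := Ideal.Quotient.eq.mp (Ideal.Quotient.mk_out (Ideal.Quotient.mk J e)) 1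
  rw [mul_one, map_sub] at h
  exact sub_eq_zero.mp h

open scoped IsMulCommutative in
/-- Pairwise commuting idempotents of the convolution algebra `C → K` take only finitely many
values at a given element of the coalgebra `C`. -/
lemma finite_apply_of_commute_idempotent {k K C : Type*} [Field k] [Field K] [Algebra k K]
    [AddCommGroup C] [Module k C] [Coalgebra k C] (T : Set (WithConv (C →ₗ[k] K)))
    (hcomm : ∀ e ∈ T, ∀ e' ∈ T, e * e' = e' * e) (hidem : ∀ e ∈ T, e * e = e) (f : C) :
    ((fun e : WithConv (C →ₗ[k] K) => e.ofConv f) '' T).Finite := by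
  have := Algebra.isMulCommutative_adjoin K hcomm
  let r := Coalgebra.Repr.arbitrary k f
  -- With `Δf = ∑ fᵢ ⊗ fᵢ'`, one has `(e * g)(f) = ∑ e(fᵢ) g(fᵢ')`, which vanishes once `e` kills
  -- the finitely many `fᵢ`. Hence the form has finite rank.
  let l : Algebra.adjoin K T →ₗ[K] K :=
    { toFun := fun e => (e : WithConv (C →ₗ[k] K)).ofConv f
      map_add' := fun _ _ => rfl
      map_smul' := fun _ _ => rfl }
  let ev : Algebra.adjoin K T →ₗ[K] (r.index → K) :=
    { toFun := fun e i => (e : WithConv (C →ₗ[k] K)).ofConv (r.left i)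
      map_add' := fun _ _ => rfl
      map_smul' := fun _ _ => rfl }
  refine (finite_image_isIdempotentElem l ev fun e g he => ?_).subset ?_
  · refine (r.convMul_apply (e : WithConv (C →ₗ[k] K)) g).trans ?_
    refine Finset.sum_eq_zero fun i hi => ?_
    have h : (e : WithConv (C →ₗ[k] K)).ofConv (r.left i) = 0 := congrFun he ⟨i, hi⟩
    rw [h, zero_mul]
  · rintro _ ⟨e, he, rfl⟩
    exact ⟨⟨e, Algebra.subset_adjoin he⟩, Subtype.ext (hidem e he), rfl⟩

/-- A finitely supported function is determined by its graph over the support, a finite subset of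
the countable set `ι × F`. -/
lemma countable_finsupp_of_forall_mem {ι β : Type*} [Countable ι] [Zero β] {F : Set β}
    (hF : F.Countable) : {φ : ι →₀ β | ∀ i, φ i ∈ F}.Countable := by
  classical
  have h := Set.countable_ofPred_finite_subset ((Set.countable_univ (α := ι)).prod hF)
  refine (h.preimage_of_injOn (f := fun φ : ι →₀ β => (φ.graph : Set (ι × β)))
    ?_).mono ?_
  · intro φ _ ψ _ hφψ
    exact Finsupp.graph_injective _ _ (Finset.coe_injective hφψ)
  · intro φ hφ
    refine ⟨Finset.finite_toSet _, ?_⟩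
    rintro ⟨i, c⟩ hc
    rw [Finset.mem_coe, Finsupp.mk_mem_graph_iff] at hc
    exact ⟨trivial, hc.1 ▸ hφ i⟩

/-! ### Weights of the Deligne torus -/

namespace DeligneRing

open AddMonoidAlgebra (single)

/-- The expansion of functions on the Deligne torus in the characters `z^m z̄^n`, with values in
the group algebra over `ℂ` of the character group `ℤ × ℤ`. -/
noncomputable def expand : DeligneRing →ₐ[ℝ] AddMonoidAlgebra ℂ (ℤ × ℤ) :=
  -- For `z = a + bi`: `a = (z + z̄)/2` and `b = -i(z - z̄)/2`. Then `a² + b² = z z̄`, with inverse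
  -- the character `(-1, -1)`.
  lift (single (1, 0) (1 / 2) + single (0, 1) (1 / 2))
    (single (1, 0) (-Complex.I / 2) + single (0, 1) (Complex.I / 2)) (by
    refine IsUnit.of_mul_eq_one (single (-1, -1) 1) ?_
    have h : (single (1, 0) (1 / 2) + single (0, 1) (1 / 2)) ^ 2 +
        (single (1, 0) (-Complex.I / 2) + single (0, 1) (Complex.I / 2)) ^ 2 =
        (single (1, 1) 1 : AddMonoidAlgebra ℂ (ℤ × ℤ)) := by
      ext χ
      simp [sq, add_mul, mul_add, AddMonoidAlgebra.single_mul_single, Finsupp.single_apply]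
      split_ifs <;> ring_nf <;> simp <;> ring
    rw [h, AddMonoidAlgebra.single_mul_single, mul_one]
    rfl)

lemma expand_a : expand a = single (1, 0) (1 / 2) + single (0, 1) (1 / 2) := lift_a _ _ _

lemma expand_b : expand b = single (1, 0) (-Complex.I / 2) + single (0, 1) (Complex.I / 2) :=
  lift_b _ _ _

/-- The homomorphism `(m, n) ↦ z ^ m * w ^ n`. -/
noncomputable def zpowPairHom {R : Type*} [CommRing R] (z w : Rˣ) :
    Multiplicative (ℤ × ℤ) →* R :=
  (Units.coeHom R).comp
    { toFun := fun χ => z ^ χ.toAdd.1 * w ^ χ.toAdd.2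
      map_one' := by simp
      map_mul' := fun χ ψ => by
        simp only [toAdd_mul, Prod.fst_add, Prod.snd_add, zpow_add]
        rw [mul_mul_mul_comm] }

/-- The character `a + b c` for a square root `c` of `-1`, as a unit of `ℂ ⊗ O(𝕊)`. -/
noncomputable def charUnit (c : ℂ) (hc : c ^ 2 = -1) : (ℂ ⊗[ℝ] DeligneRing)ˣ :=
  Units.mkOfMulEqOne (1 ⊗ₜ a + c ⊗ₜ b) ((1 ⊗ₜ a - c ⊗ₜ b) * 1 ⊗ₜ normInv) (by
    have h : (1 ⊗ₜ a + c ⊗ₜ b) * (1 ⊗ₜ a - c ⊗ₜ b) = (1 : ℂ) ⊗ₜ[ℝ] (a ^ 2 + b ^ 2) := by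
      rw [← sq_sub_sq, Algebra.TensorProduct.tmul_pow, Algebra.TensorProduct.tmul_pow, hc,
        TensorProduct.neg_tmul, one_pow, sub_neg_eq_add, TensorProduct.tmul_add]
    rw [← mul_assoc, h, Algebra.TensorProduct.tmul_mul_tmul, norm_mul_normInv, one_mul]
    rfl)

/-- Substituting `a + bi` and `a - bi` for the two basic characters gives a map `σ` to `ℂ ⊗ O(𝕊)`,
and `σ ∘ expand` is the injection `f ↦ 1 ⊗ f`. -/
lemma expand_injective : Function.Injective expand := by
  let z := charUnit Complex.I Complex.I_sq
  let w := charUnit (-Complex.I) (by rw [neg_sq, Complex.I_sq])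
  let F := zpowPairHom z w
  let σ := (AddMonoidAlgebra.lift ℂ (ℂ ⊗[ℝ] DeligneRing) (ℤ × ℤ) F).restrictScalars ℝ
  have h : σ.comp expand = Algebra.TensorProduct.includeRight := by
    apply algHom_ext
    · simp [σ, expand_a, F, zpowPairHom, z, w, charUnit, smul_add, TensorProduct.smul_tmul']
      rw [add_add_add_comm, ← TensorProduct.add_tmul, ← TensorProduct.add_tmul]
      norm_num
    · simp [σ, expand_b, F, zpowPairHom, z, w, charUnit, smul_add, TensorProduct.smul_tmul']
      rw [add_add_add_comm, ← TensorProduct.add_tmul, ← TensorProduct.add_tmul]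
      ring_nf
      simp
  have hinj : Function.Injective (σ.comp expand) := by
    rw [h]
    exact Algebra.TensorProduct.includeRight_injective (algebraMap ℝ ℂ).injective
  exact Function.Injective.of_comp (f := σ) (by simpa using hinj)

/-- The coefficient of the character `z^m z̄^n`. -/
noncomputable def coeff (χ : ℤ × ℤ) : DeligneRing →ₗ[ℝ] ℂ where
  toFun f := (expand f).coeff χ
  map_add' := by simp
  map_smul' := by simp

lemma coeff_mapDomain_inl_mul_mapDomain_inr {K G H : Type*} [Semiring K] [AddMonoid G]
    [AddMonoid H] (p : AddMonoidAlgebra K G) (q : AddMonoidAlgebra K H) (χ : G) (ψ : H) :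
    (AddMonoidAlgebra.mapDomain (AddMonoidHom.inl G H) p *
      AddMonoidAlgebra.mapDomain (AddMonoidHom.inr G H) q).coeff (χ, ψ) =
        p.coeff χ * q.coeff ψ := by
  classical
  induction p using AddMonoidAlgebra.induction_linear with
  | zero => simp
  | add p p' hp hp' =>
    simp only [AddMonoidAlgebra.mapDomain_add, add_mul, AddMonoidAlgebra.coeff_add,
      Finsupp.add_apply, hp, hp']
  | single g c =>
    induction q using AddMonoidAlgebra.induction_linear with
    | zero => simp
    | add q q' hq hq' =>
      simp only [AddMonoidAlgebra.mapDomain_add, mul_add, AddMonoidAlgebra.coeff_add,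
        Finsupp.add_apply, hq, hq']
    | single h c' =>
      simp [AddMonoidAlgebra.single_mul_single, Finsupp.single_apply, Prod.ext_iff, ite_and]
      split_ifs <;> simp

/-- Characters are group-like, so comultiplication becomes the diagonal `χ ↦ (χ, χ)` on expansions.
This makes `coeff χ` a convolution idempotent. -/
lemma coeff_mul_apply_comul (χ : ℤ × ℤ) (f : DeligneRing) :
    LinearMap.mul' ℝ ℂ (TensorProduct.map (coeff χ) (coeff χ) (Coalgebra.comul f)) = coeff χ f := by
  let i₁ : AddMonoidAlgebra ℂ (ℤ × ℤ) →ₐ[ℝ] AddMonoidAlgebra ℂ ((ℤ × ℤ) × (ℤ × ℤ)) :=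
    AddMonoidAlgebra.mapDomainAlgHom ℝ ℂ (AddMonoidHom.inl _ _)
  let i₂ : AddMonoidAlgebra ℂ (ℤ × ℤ) →ₐ[ℝ] AddMonoidAlgebra ℂ ((ℤ × ℤ) × (ℤ × ℤ)) :=
    AddMonoidAlgebra.mapDomainAlgHom ℝ ℂ (AddMonoidHom.inr _ _)
  let d : AddMonoidAlgebra ℂ (ℤ × ℤ) →ₐ[ℝ] AddMonoidAlgebra ℂ ((ℤ × ℤ) × (ℤ × ℤ)) :=
    AddMonoidAlgebra.mapDomainAlgHom ℝ ℂ ((AddMonoidHom.id _).prod (AddMonoidHom.id _))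
  let m : DeligneRing ⊗[ℝ] DeligneRing →ₐ[ℝ] AddMonoidAlgebra ℂ ((ℤ × ℤ) × (ℤ × ℤ)) :=
    Algebra.TensorProduct.productMap (i₁.comp expand) (i₂.comp expand)
  have hd : m.comp comulHom = d.comp expand := by
    apply algHom_ext <;>
    · simp only [AlgHom.comp_apply, comulHom, lift_a, lift_b, map_sub, m,
        Algebra.TensorProduct.productMap_apply_tmul, expand_a, expand_b, map_add, i₁, i₂, d,
        AddMonoidAlgebra.mapDomainAlgHom_apply, AddMonoidAlgebra.mapDomain_single, mul_add, add_mul,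
        AddMonoidAlgebra.single_mul_single]
      ext ψ
      simp [Finsupp.single_apply]
      split_ifs <;> ring_nf <;> simp <;> ring
  have hm : ∀ t : DeligneRing ⊗[ℝ] DeligneRing,
      LinearMap.mul' ℝ ℂ (TensorProduct.map (coeff χ) (coeff χ) t) = (m t).coeff (χ, χ) := by
    intro t
    induction t with
    | zero => simp
    | add s t hs ht => simp only [map_add, hs, ht]; rfl
    | tmul f g =>
      simp only [m, Algebra.TensorProduct.productMap_apply_tmul, TensorProduct.map_tmul,
        LinearMap.mul'_apply]
      exact (coeff_mapDomain_inl_mul_mapDomain_inr _ _ _ _).symm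
  have hd' : ∀ p, (d p).coeff (χ, χ) = p.coeff χ := fun p =>
    Finsupp.mapDomain_apply (f := fun ψ : ℤ × ℤ => (ψ, ψ)) (fun _ _ h => (Prod.ext_iff.mp h).1)
      p.coeff χ
  rw [hm]
  exact (congrArg (fun t => AddMonoidAlgebra.coeff t (χ, χ)) (AlgHom.congr_fun hd f)).trans (hd' _)

end DeligneRing

/-! ### Points of algebraic groups and the kernel of the adjoint quotient -/

namespace AlgGrp

section Points

variable {k : Type} [Field k] {G : AlgGrp.{u} k} {H : AlgGrp.{v} k} {R R' R'' : Type*}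
  [CommRing R] [Algebra k R] [CommRing R'] [Algebra k R'] [CommRing R''] [Algebra k R'']

lemma Points.map_mul (f : R →ₐ[k] R') (g h : G.Points R) :
    Points.map f (g * h) = g.map f * h.map f :=
  WithConv.ext (AlgHom.comp_convMul_distrib f g h)

lemma Points.map_one (f : R →ₐ[k] R') : Points.map f (1 : G.Points R) = 1 := by
  apply WithConv.ext
  ext a
  simp [Points.map, AlgHom.convOne_def]

lemma Hom.onPoints_mul (φ : Hom G H) (g h : G.Points R) :
    φ.onPoints (g * h) = φ.onPoints g * φ.onPoints h :=
  WithConv.ext (AlgHom.convMul_comp_bialgHom_distrib g h φ)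

lemma Hom.onPoints_one (φ : Hom G H) : φ.onPoints (1 : G.Points R) = 1 := by
  apply WithConv.ext
  ext a
  simp [Hom.onPoints, AlgHom.convOne_def]

lemma Hom.onPoints_inv (φ : Hom G H) (g : G.Points R) :
    φ.onPoints g⁻¹ = (φ.onPoints g)⁻¹ :=
  eq_inv_of_mul_eq_one_left (by rw [← φ.onPoints_mul, inv_mul_cancel, φ.onPoints_one])

lemma Hom.onPoints_map (φ : Hom G H) (f : R →ₐ[k] R') (g : G.Points R) :
    φ.onPoints (g.map f) = (φ.onPoints g).map f := rfl

/-- The difference of two points with the same image in the adjoint group is central. -/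
lemma AdjointQuotient.commute_of_onPoints_eq {R R' : Type} [CommRing R] [Algebra k R]
    [CommRing R'] [Algebra k R'] (P : AdjointQuotient G) {y y' : G.Points R}
    (h : P.proj.onPoints y = P.proj.onPoints y') (f : R →ₐ[k] R') (g : G.Points R') :
    Commute (Points.map f (y⁻¹ * y')) g := by
  -- `ker_eq_centre` and `IsCentral` range over algebras in universe `u`, so the points are lifted
  -- there and the identity is brought back down.
  let up : R →ₐ[k] ULift.{u} R := (ULift.algEquiv (R := k)).symm.toAlgHom
  let down : ULift.{u} R →ₐ[k] R := (ULift.algEquiv (R := k)).toAlgHom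
  let up' : R' →ₐ[k] ULift.{u} R' := (ULift.algEquiv (R := k)).symm.toAlgHom
  let down' : ULift.{u} R' →ₐ[k] R' := (ULift.algEquiv (R := k)).toAlgHom
  generalize hz : y⁻¹ * y' = z
  have hz1 : P.proj.onPoints z = 1 := by
    rw [← hz, Hom.onPoints_mul, Hom.onPoints_inv, h, inv_mul_cancel]
  have h1 : P.proj.onPoints (Points.map up z) = 1 := by
    rw [Hom.onPoints_map, hz1, Points.map_one]
  have h2 := (P.ker_eq_centre _ _).mp h1 _ (up'.comp (f.comp down)) (g.map up')
  have h3 : Points.map up' (z.map f * g) = Points.map up' (g * z.map f) := by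
    rw [Points.map_mul, Points.map_mul]
    exact h2
  have h4 (w : G.Points R') : Points.map down' (Points.map up' w) = w := rfl
  rw [Commute, SemiconjBy, ← h4 (z.map f * g), h3, h4]

end Points

end AlgGrp

open AlgGrp

/-! ### Homomorphisms `𝕊 → G_ℝ` as `O(𝕊)`-valued points -/

namespace DeligneHom

variable {G : AlgGrp.{u} ℚ} {H : AlgGrp.{v} ℚ}

/-- The comorphism of `h : 𝕊 → G_ℝ`. -/
def comorphism (h : DeligneHom G) : ℝ ⊗[ℚ] G.coord →ₐc[ℝ] DeligneRing := h

/-- A homomorphism `𝕊 → G_ℝ`, read as a point of `G` with values in `O(𝕊)`. -/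
noncomputable def toPoint (h : DeligneHom G) : G.Points DeligneRing :=
  toConv ((AlgHom.restrictScalars ℚ (h.comorphism : ℝ ⊗[ℚ] G.coord →ₐ[ℝ] DeligneRing)).comp
      Algebra.TensorProduct.includeRight)

lemma toPoint_apply (h : DeligneHom G) (f : G.coord) :
    h.toPoint.ofConv f = h.comorphism (1 ⊗ₜ f) := rfl

lemma toPoint_injective : Function.Injective (toPoint (G := G)) := by
  intro h h' hh
  have : (h.comorphism : ℝ ⊗[ℚ] G.coord →ₐ[ℝ] DeligneRing) = h'.comorphism := by
    apply Algebra.TensorProduct.ext'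
    intro c f
    have hf : h.comorphism (1 ⊗ₜ f) = h'.comorphism (1 ⊗ₜ f) :=
      AlgHom.congr_fun (congrArg ofConv hh) f
    rw [show c ⊗ₜ[ℚ] f = c • (1 ⊗ₜ[ℚ] f : ℝ ⊗[ℚ] G.coord) by
      rw [TensorProduct.smul_tmul', smul_eq_mul, mul_one]]
    rw [map_smul, map_smul]
    exact congrArg (c • ·) hf
  exact DFunLike.ext _ _ fun a => AlgHom.congr_fun this a

lemma toPoint_push (h : DeligneHom G) (φ : Hom G H) :
    (h.push φ).toPoint = φ.onPoints h.toPoint := rfl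

/-- The first factor `O(𝕊) → O(𝕊 × 𝕊)`. -/
noncomputable def inclFst : DeligneRing →ₐ[ℚ] DeligneRing ⊗[ℝ] DeligneRing :=
  AlgHom.restrictScalars ℚ (Algebra.TensorProduct.includeLeft (R := ℝ) (S := ℝ))

/-- The second factor `O(𝕊) → O(𝕊 × 𝕊)`. -/
noncomputable def inclSnd : DeligneRing →ₐ[ℚ] DeligneRing ⊗[ℝ] DeligneRing :=
  AlgHom.restrictScalars ℚ (Algebra.TensorProduct.includeRight (R := ℝ))

lemma map_inclFst_mul_map_inclSnd_apply (p q : G.Points DeligneRing) {ι : Type*} {f : G.coord}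
    (r : Coalgebra.Repr ℚ f ι) :
    (p.map inclFst * q.map inclSnd).ofConv f =
      ∑ i ∈ r.index, p.ofConv (r.left i) ⊗ₜ[ℝ] q.ofConv (r.right i) := by
  refine (r.convMul_apply (toConv (p.map inclFst).ofConv.toLinearMap)
    (toConv (q.map inclSnd).ofConv.toLinearMap)).trans (Finset.sum_congr rfl fun i _ => ?_)
  simp [Points.map, inclFst, inclSnd]

lemma map_inclSnd_mul_map_inclFst_apply (p q : G.Points DeligneRing) {ι : Type*} {f : G.coord}
    (r : Coalgebra.Repr ℚ f ι) :
    (p.map inclSnd * q.map inclFst).ofConv f =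
      ∑ i ∈ r.index, q.ofConv (r.right i) ⊗ₜ[ℝ] p.ofConv (r.left i) := by
  refine (r.convMul_apply (toConv (p.map inclSnd).ofConv.toLinearMap)
    (toConv (q.map inclFst).ofConv.toLinearMap)).trans (Finset.sum_congr rfl fun i _ => ?_)
  simp [Points.map, inclFst, inclSnd]

/-- This is `h(zw) = h(z) h(w)` for the universal pair of points `(z, w)` of `𝕊 × 𝕊`. -/
lemma comul_toPoint_apply (h : DeligneHom G) (f : G.coord) :
    (Coalgebra.comul (R := ℝ) (h.toPoint.ofConv f) : DeligneRing ⊗[ℝ] DeligneRing) =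
      (h.toPoint.map inclFst * h.toPoint.map inclSnd).ofConv f := by
  let r := Coalgebra.Repr.arbitrary ℚ f
  rw [map_inclFst_mul_map_inclSnd_apply _ _ r, toPoint_apply,
    ← CoalgHomClass.map_comp_comul_apply, TensorProduct.comul_tmul, ← r.eq]
  simp [TensorProduct.tmul_sum, toPoint_apply]

lemma comm_comul (f : DeligneRing) :
    TensorProduct.comm ℝ DeligneRing DeligneRing (Coalgebra.comul f) = Coalgebra.comul f := by
  have h : ((Algebra.TensorProduct.comm ℝ DeligneRing DeligneRing : _ →ₐ[ℝ] _).comp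
      DeligneRing.comulHom) = DeligneRing.comulHom := by
    apply DeligneRing.algHom_ext <;> simp [DeligneRing.comulHom, add_comm]
  exact AlgHom.congr_fun h f

/-- Since `𝕊` is commutative, `h(z) h(w) = h(zw) = h(wz) = h(w) h(z)`. -/
lemma commute_toPoint (h : DeligneHom G) :
    Commute (h.toPoint.map inclFst) (h.toPoint.map inclSnd) := by
  apply WithConv.ext
  ext f
  let r := Coalgebra.Repr.arbitrary ℚ f
  rw [map_inclSnd_mul_map_inclFst_apply _ _ r, ← comul_toPoint_apply, ← comm_comul,
    comul_toPoint_apply, map_inclFst_mul_map_inclSnd_apply _ _ r, map_sum]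
  simp

end DeligneHom

/-! ### Countability of commuting families -/

/-- A family of homomorphisms `𝕊 → G_ℝ` that commute pairwise is countable. -/
lemma countable_of_commute {G : AlgGrp.{u} ℚ} (S : Set (DeligneHom G))
    (hS : ∀ h ∈ S, ∀ h' ∈ S, Commute (h.toPoint.map DeligneHom.inclFst)
      (h'.toPoint.map DeligneHom.inclSnd)) : S.Countable := by
  let weight (p : G.Points DeligneRing) (χ : ℤ × ℤ) : WithConv (G.coord →ₗ[ℚ] ℂ) :=
    toConv ((DeligneRing.coeff χ).restrictScalars ℚ ∘ₗ p.ofConv.toLinearMap)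
  -- Both orders of the convolution product are `(χ, ψ)`-coefficients, of `f(p(z) q(w))` here and of
  -- `f(q(w) p(z))` in `weight_mul'`, so commuting points have commuting weights.
  have weight_mul (p q : G.Points DeligneRing) (χ ψ : ℤ × ℤ) (f : G.coord) :
      (weight p χ * weight q ψ).ofConv f = LinearMap.mul' ℝ ℂ
        (TensorProduct.map (DeligneRing.coeff χ) (DeligneRing.coeff ψ)
          ((p.map DeligneHom.inclFst * q.map DeligneHom.inclSnd).ofConv f)) := by
    let r := Coalgebra.Repr.arbitrary ℚ f
    rw [DeligneHom.map_inclFst_mul_map_inclSnd_apply p q r]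
    refine (r.convMul_apply _ _).trans ?_
    simp [weight]
  have weight_mul' (p q : G.Points DeligneRing) (χ ψ : ℤ × ℤ) (f : G.coord) :
      (weight q ψ * weight p χ).ofConv f = LinearMap.mul' ℝ ℂ
        (TensorProduct.map (DeligneRing.coeff χ) (DeligneRing.coeff ψ)
          ((q.map DeligneHom.inclSnd * p.map DeligneHom.inclFst).ofConv f)) := by
    let r := Coalgebra.Repr.arbitrary ℚ f
    rw [DeligneHom.map_inclSnd_mul_map_inclFst_apply q p r]
    refine (r.convMul_apply _ _).trans ?_
    simp [weight, mul_comm]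
  let T : Set (WithConv (G.coord →ₗ[ℚ] ℂ)) := {e | ∃ h ∈ S, ∃ χ, e = weight h.toPoint χ}
  have hfin (f : G.coord) : ((fun e : WithConv (G.coord →ₗ[ℚ] ℂ) => e.ofConv f) '' T).Finite := by
    apply finite_apply_of_commute_idempotent
    · rintro _ ⟨h, hh, χ, rfl⟩ _ ⟨h', hh', χ', rfl⟩
      apply WithConv.ext
      ext f
      rw [weight_mul, weight_mul', (hS h hh h' hh').eq]
    · rintro _ ⟨h, hh, χ, rfl⟩
      apply WithConv.ext
      ext f
      rw [weight_mul, ← DeligneHom.comul_toPoint_apply, DeligneRing.coeff_mul_apply_comul]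
      rfl
  -- By `expand_injective`, `f ∘ h` is determined by its finitely supported coefficients, all in the
  -- finite set of `hfin f`.
  have hcount (f : G.coord) : ((fun h : DeligneHom G => h.toPoint.ofConv f) '' S).Countable := by
    refine ((countable_finsupp_of_forall_mem (ι := ℤ × ℤ) (hfin f).countable).preimage_of_injOn
      (f := fun t : DeligneRing => (DeligneRing.expand t).coeff) ?_).mono ?_
    · exact (AddMonoidAlgebra.coeff_injective.comp DeligneRing.expand_injective).injOn
    · rintro _ ⟨h, hh, rfl⟩ χ
      exact ⟨_, ⟨h, hh, χ, rfl⟩, rfl⟩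
  obtain ⟨s, hs⟩ := (Algebra.FiniteType.out : (⊤ : Subalgebra ℚ G.coord).FG)
  have : (Set.univ.pi fun f : s =>
      (fun h : DeligneHom G => h.toPoint.ofConv (f : G.coord)) '' S).Countable :=
    Set.countable_univ_pi fun f => hcount f
  refine (this.preimage_of_injOn
    (f := fun (h : DeligneHom G) (f : s) => h.toPoint.ofConv (f : G.coord)) ?_).mono ?_
  · intro h _ h' _ hh
    apply DeligneHom.toPoint_injective
    apply WithConv.ext
    apply AlgHom.ext_of_adjoin_eq_top hs
    intro f hf
    exact congrFun hh ⟨f, hf⟩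
  · intro h hh f _
    exact ⟨h, hh, rfl⟩

/-! ### Stratification of the hybrid Hecke orbit -/

instance AlgGrp.countable_coord (G : AlgGrp.{u} ℚ) : Countable G.coord := by
  obtain ⟨n, f, hf⟩ := Algebra.FiniteType.iff_quotient_mvPolynomial''.mp G.finiteType
  have : Countable (MvPolynomial (Fin n) ℚ) :=
    Cardinal.mk_le_aleph0_iff.mp (MvPolynomial.cardinalMk_le_max.trans (by simp))
  exact hf.countable

lemma countable_ideal_of_isNoetherianRing (R : Type*) [CommRing R] [Countable R]
    [IsNoetherianRing R] : Countable (Ideal R) := by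
  have h : Function.Surjective (fun s : Finset R => Ideal.span (s : Set R)) :=
    fun I => IsNoetherian.noetherian I
  exact h.countable

instance AlgGrp.isNoetherianRing_coord (G : AlgGrp.{u} ℚ) : IsNoetherianRing G.coord :=
  Algebra.FiniteType.isNoetherianRing ℚ G.coord

/-- The points `x' ∈ X` that factor through the closed subgroup of `G` defined by the ideal `I`,
such that the adjoint quotient of this subgroup is generated by the functions `s`, `(s, t) ∈ l`,
and `s ∘ x' = t ∘ x` for these functions. -/
def orbitStratum (D : ShimuraDatum.{u}) (M : ShimuraDatum.{v}) (x : DeligneHom M.G)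
    (I : Ideal D.G.coord) (l : List (D.G.coord × M.G.coord)) : Set (DeligneHom D.G) :=
  {x' | (∃ (H : AlgGrp.{u} ℚ) (ι : Hom H D.G) (y : DeligneHom H) (P : AdjointQuotient H),
      ι.IsClosedImmersion ∧ y.push ι = x' ∧
      RingHom.ker (ι : D.G.coord →ₐ[ℚ] H.coord) = I ∧
      Set.range P.proj ⊆ Algebra.adjoin ℚ (ι '' {s | ∃ p ∈ l, p.1 = s})) ∧
    ∀ p ∈ l, x'.toPoint.ofConv p.1 = x.toPoint.ofConv p.2}

lemma commute_of_mem_orbitStratum {D : ShimuraDatum.{u}} {M : ShimuraDatum.{v}}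
    {x : DeligneHom M.G} {I : Ideal D.G.coord} {l : List (D.G.coord × M.G.coord)}
    {x₁ x₂ : DeligneHom D.G} (h₁ : x₁ ∈ orbitStratum D M x I l)
    (h₂ : x₂ ∈ orbitStratum D M x I l) :
    Commute (x₁.toPoint.map DeligneHom.inclFst) (x₂.toPoint.map DeligneHom.inclSnd) := by
  obtain ⟨⟨H, ι, y, P, hι, rfl, rfl, hP⟩, hl₁⟩ := h₁
  obtain ⟨⟨H₂, ι₂, y₂, -, -, rfl, hker, -⟩, hl₂⟩ := h₂
  -- the second point factors through `H`
  obtain ⟨y', hy'⟩ : ∃ y' : H.Points DeligneRing, ι.onPoints y' = (y₂.push ι₂).toPoint := by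
    have hle : RingHom.ker (ι : D.G.coord →ₐ[ℚ] H.coord) ≤
        RingHom.ker (y₂.push ι₂).toPoint.ofConv := by
      rw [← hker]
      intro a ha
      have ha' : ι₂ a = 0 := ha
      change y₂.toPoint.ofConv (ι₂ a) = 0
      rw [ha', map_zero]
    exact ⟨toConv (AlgHom.liftOfSurjective (ι : D.G.coord →ₐ[ℚ] H.coord) hι _ hle),
      WithConv.ext (AlgHom.liftOfSurjective_comp (ι : D.G.coord →ₐ[ℚ] H.coord) hι _ hle)⟩
  have hy : ι.onPoints y.toPoint = (y.push ι).toPoint := rfl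
  have hproj : P.proj.onPoints y.toPoint = P.proj.onPoints y' := by
    apply WithConv.ext
    ext f
    change y.toPoint.ofConv (P.proj f) = y'.ofConv (P.proj f)
    have hf := hP ⟨f, rfl⟩
    -- The functions on which `y` and `y'` agree form a subalgebra. It contains the generators
    -- because both points send `s` to `t ∘ x`.
    have hle : Algebra.adjoin ℚ (ι '' {s | ∃ p ∈ l, p.1 = s}) ≤
        AlgHom.equalizer y.toPoint.ofConv y'.ofConv := by
      rw [Algebra.adjoin_le_iff]
      rintro _ ⟨s, ⟨p, hp, rfl⟩, rfl⟩
      have e := AlgHom.congr_fun (congrArg ofConv hy') p.1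
      exact (hl₁ p hp).trans ((hl₂ p hp).symm.trans e.symm)
    exact hle hf
  have hz := P.commute_of_onPoints_eq hproj DeligneHom.inclSnd
    (y.toPoint.map DeligneHom.inclFst)
  have hc : Commute (y.toPoint.map DeligneHom.inclFst) (y'.map DeligneHom.inclSnd) := by
    -- The first factor commutes with the other copy of `y` because `𝕊` is commutative; the second
    -- factor is central.
    have : y' = y.toPoint * (y.toPoint⁻¹ * y') := by rw [mul_inv_cancel_left]
    rw [this, Points.map_mul]
    exact Commute.mul_right (S := H.Points (DeligneRing ⊗[ℝ] DeligneRing)) y.commute_toPoint hz.symm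
  rw [← hy, ← hy', ← Hom.onPoints_map, ← Hom.onPoints_map]
  exact (ι.onPoints_mul _ _).symm.trans ((congrArg ι.onPoints hc.eq).trans (ι.onPoints_mul _ _))

lemma exists_mem_orbitStratum {D : ShimuraDatum.{u}} {M : ShimuraDatum.{v}} {x : DeligneHom M.G}
    {x' : DeligneHom D.G} (hx' : x' ∈ hybridHeckeOrbit D M x) :
    ∃ I l, x' ∈ orbitStratum D M x I l := by
  obtain ⟨-, T, P, P', φ, h⟩ := hx'
  obtain ⟨s, hs⟩ := (Algebra.FiniteType.out : (⊤ : Subalgebra ℚ P'.grp.coord).FG)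
  choose σ hσ using T.isSubdatum.isClosedImmersion
  -- For each generator `e` of `O(M_{x'}^ad)`, its pullback to `M_{x'}` is lifted to `O(G)` and
  -- paired with the pullback of `φ e` to `M`. Evaluating `φ ∘ x^ad = x'^ad` at `e` gives the
  -- required equation.
  let l := s.toList.map fun e => (σ (P'.proj e), P.proj (φ e))
  refine ⟨_, l, ⟨T.datum.G, T.incl, T.point, P', T.isSubdatum.isClosedImmersion, T.push_point, rfl,
    ?_⟩, ?_⟩
  · rintro _ ⟨f, rfl⟩
    have hle : (⊤ : Subalgebra ℚ P'.grp.coord) ≤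
        (Algebra.adjoin ℚ (T.incl '' {s | ∃ p ∈ l, p.1 = s})).comap
          (P'.proj : P'.grp.coord →ₐ[ℚ] T.datum.G.coord) := by
      rw [← hs, Algebra.adjoin_le_iff]
      intro e he
      refine Algebra.subset_adjoin ⟨σ (P'.proj e), ⟨(σ (P'.proj e), P.proj (φ e)), ?_, rfl⟩, hσ _⟩
      exact List.mem_map_of_mem (Finset.mem_toList.mpr he)
    exact hle trivial
  · intro p hp
    obtain ⟨e, he, rfl⟩ := List.mem_map.mp hp
    have h' := AlgHom.congr_fun (congrArg (fun z => (DeligneHom.toPoint z).ofConv) h) e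
    have h'' := AlgHom.congr_fun (congrArg (fun z => (DeligneHom.toPoint z).ofConv) T.push_point)
      (σ (P'.proj e))
    exact h''.symm.trans ((congrArg T.point.toPoint.ofConv (hσ (P'.proj e))).trans h'.symm)

end HybridHecke

theorem mainTheorem8 (D : HybridHecke.ShimuraDatum.{u}) (M : HybridHecke.ShimuraDatum.{v})
    (x : HybridHecke.DeligneHom M.G) (hx : x ∈ M.X) (hgen : HybridHecke.IsHodgeGeneric M x) :
    (HybridHecke.hybridHeckeOrbit D M x).Countable := by
  have := HybridHecke.countable_ideal_of_isNoetherianRing D.G.coord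
  refine Set.Countable.mono (s₂ := ⋃ (I : Ideal D.G.coord), ⋃ (l : List (D.G.coord × M.G.coord)),
    HybridHecke.orbitStratum D M x I l) ?_ ?_
  · intro x' hx'
    obtain ⟨I, l, h⟩ := HybridHecke.exists_mem_orbitStratum hx'
    exact Set.mem_iUnion₂.mpr ⟨I, l, h⟩
  · exact Set.countable_iUnion fun I => Set.countable_iUnion fun l =>
      HybridHecke.countable_of_commute _ fun h hh h' hh' =>
        HybridHecke.commute_of_mem_orbitStratum hh hh'
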